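/- Let $k$ be a field, let $R$ be a commutative $k$-algebra, and let $\mathfrak D=\mathrm{Der}_k(R)$ be the Lie algebra of $k$-derivations of $R$. Let $\nabla$ be a connection on $\mathfrak D$, that is, a map $\mathfrak D\times\mathfrak D\to\mathfrak D$, $(E,F)\mapsto\nabla_EF$, additive in $E$ and in $F$, with $\nabla_{fE}F=f\nabla_EF$ and $\nabla_E(fF)=f\nabla_EF+E(f)F$ for $f\in R$. Let $k\mathcal{LT}(\mathfrak D)$ be the vector space over $k$ whose basis is the set of finite ordered rooted trees in which every node except the root is labeled by an element of $\mathfrak D$. The product of two trees is $T_1\cdot T_2=\sum_d T_d$, where $d$ runs over all functions from the set of children of the root of $T_1$ to the set of nodes of $T_2$, and $T_d$ is obtained from $T_2$ by linking every child $b$ of the root of $T_1$, with its descendants, to the node $d(b)$; the linked nodes precede the old children of $d(b)$, and those linked to the same node keep their order. The unit is the tree with one node. The coproduct is $\Delta(T)=\sum_X T_X\otimes T_{X^c}$, where $X$ runs over all subsets of the set of children of the root of $T$ and $T_X$ is the tree formed by the root, the children in $X$ and their descendants. The counit $\epsilon$ is $1$ on the tree with one node and $0$ on all other trees. With these operations $k\mathcal{LT}(\mathfrak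 D)$ is a Hopf algebra. Write $\mathrm v(E)$ for the tree whose root has a single child, labeled $E$ and without children, and $\mathrm u(E;T)$ for the tree whose root has a single child, labeled $E$, whose list of children (with their descendants) is that of the root of $T$. Consider the following rules for a $k$-linear map $\psi:k\mathcal{LT}(\mathfrak D)\to\mathrm{End}_k(R)$: 1. $\psi$ sends the tree with one node to the identity; 2. $\psi(\mathrm v(E))=E$ for all $E\in\mathfrak D$; 3. $\psi(\mathrm u(E;\mathrm v(F)))=\nabla_FE$ for all $E,F\in\mathfrak D$; 4. if $T$ is a tree whose root has a single child and $\psi(T)=D\in\mathfrak D$, and if a tree $U'$ arises from a tree $U$ by replacing one occurrence of $T$ as a subtree (a non-root node of $U$ with all its descendants, its parent playing the role of the root) by $\mathrm v(D)$, then $\psi(U)=\psi(U')$; 5. $\psi(T\cdot U)=\psi(T)\circ\psi(U)$ for every tree $T$ whose root has a single child and every tree $U$. Then there is exactly one $k$-linear map $\psi:k\mathcal{LT}(\mathfrak D)\to\mathrm{End}_k(R)$ that obeys these rules, and it has the following properties. - $\psi$ is a homomorphism of $k$-algebras, so that $h\cdot r=\psi(h)(r)$ defines a left $k\mathcal{LT}(\mathfrak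 D)$-module structure on $R$. - This structure makes $R$ a $k\mathcal{LT}(\mathfrak D)$-module algebra: $h\cdot(rs)=\sum_{(h)}(h_{(1)}\cdot r)(h_{(2)}\cdot s)$ and $h\cdot 1=\epsilon(h)1$ for all $h\in k\mathcal{LT}(\mathfrak D)$ and $r,s\in R$. - $\psi(h)\in\mathrm{Diff}(R)$ for all $h\in k\mathcal{LT}(\mathfrak D)$, where $\mathrm{Diff}(R)$ is the $k$-subalgebra of $\mathrm{End}_k(R)$ generated by the derivations of $R$. -/

import Mathlib

universe u v w

namespace OrderedTrees

/-- A non-root node of an ordered tree, labeled by an element of `S`, together with the ordered list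
of the full subtrees hanging from it. -/
inductive Branch (S : Type u) : Type u
  | node (label : S) (children : List (Branch S)) : Branch S

/-- Ordered rooted trees in which every node except the root is labeled by an element of `S`: such a
tree is the ordered list of the branches at its (unlabeled) root.  The tree with one node is `[]`,
and identifying the roots of two trees (in order) is concatenation `T ++ U`. -/
abbrev Tree (S : Type u) : Type u := List (Branch S)

/-- The tree `v(E)`: a root with a single child, which is labeled `E`. -/
def vTree {S : Type u} (E : S) : Tree S := [Branch.node E []]

/-- The tree `u(E; T)`: its root has one child, labeled `E`, with which the root of `T` is
identified. -/
def uTree {S : Type u} (E : S) (T : Tree S) : Tree S := [Branch.node E T]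

/-- All ways to split an ordered list into a sub-list and its complement, one for every subset of
the positions; both parts keep the original order. -/
def splits {α : Type u} : List α → List (List α × List α)
  | [] => [([], [])]
  | a :: l => (splits l).flatMap fun p => [(a :: p.1, p.2), (p.1, a :: p.2)]

mutual
/-- All ways to link every branch in the list `F` to some node of the branch `t` (the top node
of `t` included).  At each node the newly linked branches come before the old children, in the order
that they have in `F`. -/
def linkBranch {S : Type u} (F : Tree S) : Branch S → List (Branch S)
  | .node a L => (splits F).flatMap fun p => (linkNonroot p.2 L).map fun X => .node a (p.1 ++ X)
/-- All ways to link every branch in the list `F` to some non-root node of a tree, with the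
same convention about the order. -/
def linkNonroot {S : Type u} (F : Tree S) : Tree S → List (Tree S)
  | [] => if F.isEmpty then [[]] else []
  | t :: G => (splits F).flatMap fun p =>
      (linkBranch p.1 t).flatMap fun s => (linkNonroot p.2 G).map fun X => s :: X
end

/-- All trees `T_d` obtained from two trees `F` and `T`, one for every function `d` from the
children of the root of `F` to the nodes of `T` (root included): every child `b` of the root of `F` is
linked, with its descendants, to the node `d b`, where it comes before the old children; children
linked to the same node keep their order. -/
def linkings {S : Type u} (F T : Tree S) : List (Tree S) :=
  (splits F).flatMap fun p => (linkNonroot p.2 T).map fun X => p.1 ++ X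

mutual
/-- All ways to link one branch `b` to a node of a branch (its top node included). -/
def insBranch {S : Type u} (b : Branch S) : Branch S → List (Branch S)
  | .node a L => .node a (b :: L) :: (insNonroot b L).map (.node a)
/-- All ways to link one branch `b` to a non-root node of a tree. -/
def insNonroot {S : Type u} (b : Branch S) : Tree S → List (Tree S)
  | [] => []
  | t :: G => (insBranch b t).map (· :: G) ++ (insNonroot b G).map (t :: ·)
end

section Combinatorics

variable {S : Type u} {M : Type w} [AddCommMonoid M]

theorem sum_flatMap' {α β : Type*} (L : List α) (g : α → List β) (f : β → M) :
    ((L.flatMap g).map f).sum = (L.map fun x => ((g x).map f).sum).sum := by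
  induction L with
  | nil => simp
  | cons a L ih => simp [ih]

theorem sum_comm' {α β : Type*} (L : List α) (L' : List β) (f : α → β → M) :
    (L.map fun x => (L'.map fun y => f x y).sum).sum =
      (L'.map fun y => (L.map fun x => f x y).sum).sum := by
  induction L with
  | nil => simp
  | cons a L ih => simp [ih, List.sum_map_add]

theorem sum_map_map' {α β : Type*} (L : List α) (g : α → β) (f : β → M) :
    ((L.map g).map f).sum = (L.map fun x => f (g x)).sum := by
  rw [List.map_map]; rfl

theorem sum_splits_cons {α : Type*} (a : α) (l : List α) (f : List α × List α → M) :
    ((splits (a :: l)).map f).sum =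
      ((splits l).map fun p => f (a :: p.1, p.2) + f (p.1, a :: p.2)).sum := by
  simp [splits, sum_flatMap']

theorem sum_insNonroot_append (b : Branch S) (A B : Tree S) (f : Tree S → M) :
    ((insNonroot b (A ++ B)).map f).sum =
      ((insNonroot b A).map fun X => f (X ++ B)).sum +
        ((insNonroot b B).map fun Y => f (A ++ Y)).sum := by
  induction A generalizing f with
  | nil => simp [insNonroot]
  | cons t A ih =>
    simp only [List.cons_append, insNonroot, List.map_append, List.sum_append, sum_map_map', ih,
      add_assoc]

theorem sum_splits_insNonroot (b : Branch S) (F : Tree S) (f : Tree S × Tree S → M) :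
    ((insNonroot b F).map fun X => ((splits X).map f).sum).sum =
      ((splits F).map fun p => ((insNonroot b p.1).map fun X => f (X, p.2)).sum +
        ((insNonroot b p.2).map fun X => f (p.1, X)).sum).sum := by
  induction F generalizing f with
  | nil => simp [insNonroot, splits]
  | cons t F ih =>
    simp only [insNonroot, List.map_append, List.sum_append, sum_map_map', sum_splits_cons,
      List.sum_map_add, ih]
    rw [sum_comm' (insBranch b t) (splits F), sum_comm' (insBranch b t) (splits F)]
    abel

theorem sum_linkings (F T : Tree S) (f : Tree S → M) :
    ((linkings F T).map f).sum =
      ((splits F).map fun p => ((linkNonroot p.2 T).map fun X => f (p.1 ++ X)).sum).sum := by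
  simp only [linkings, sum_flatMap', sum_map_map']

theorem sum_linkings_cons_of (b : Branch S) (F T : Tree S)
    (h : ∀ (F : Tree S) (f : Tree S → M),
      ((linkNonroot F T).map fun X => ((insNonroot b X).map f).sum).sum =
      ((linkNonroot (b :: F) T).map f).sum +
        ((insNonroot b F).map fun X => ((linkNonroot X T).map f).sum).sum) (f : Tree S → M) :
    ((linkings F T).map fun X => f (b :: X) + ((insNonroot b X).map f).sum).sum =
      ((linkings (b :: F) T).map f).sum +
        ((insNonroot b F).map fun X => ((linkings X T).map f).sum).sum := by
  simp only [sum_linkings, sum_splits_cons, sum_insNonroot_append, sum_splits_insNonroot,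
    List.sum_map_add, h, List.cons_append]
  have e : ∀ p : Tree S × Tree S,
      ((linkNonroot p.2 T).map fun X =>
        ((insNonroot b p.1).map fun Y => f (Y ++ X)).sum).sum =
      ((insNonroot b p.1).map fun Y => ((linkNonroot p.2 T).map fun X => f (Y ++ X)).sum).sum :=
    fun p => sum_comm' _ _ _
  simp only [e]
  abel

mutual
theorem sum_linkBranch_cons (b : Branch S) : ∀ (t : Branch S) (F : Tree S) (f : Branch S → M),
    ((linkBranch F t).map fun s => ((insBranch b s).map f).sum).sum =
      ((linkBranch (b :: F) t).map f).sum +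
        ((insNonroot b F).map fun X => ((linkBranch X t).map f).sum).sum
  | .node a L => fun F f => by
    have := sum_linkings_cons_of b F L (sum_linkNonroot_cons b L) (fun X => f (.node a X))
    simp only [sum_linkings] at this
    simpa only [linkBranch, sum_flatMap', sum_map_map', insBranch, List.map_cons, List.sum_cons]
      using this
theorem sum_linkNonroot_cons (b : Branch S) : ∀ (T : Tree S) (F : Tree S) (f : Tree S → M),
    ((linkNonroot F T).map fun X => ((insNonroot b X).map f).sum).sum =
      ((linkNonroot (b :: F) T).map f).sum +
        ((insNonroot b F).map fun X => ((linkNonroot X T).map f).sum).sum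
  | [] => fun F f => by
    cases F with
    | nil => simp [linkNonroot, insNonroot]
    | cons c F =>
      have : ∀ X ∈ insNonroot b (c :: F), X.isEmpty = false := by
        intro X hX
        simp only [insNonroot, List.mem_append, List.mem_map] at hX
        rcases hX with ⟨_, _, rfl⟩ | ⟨_, _, rfl⟩ <;> rfl
      have h2 : ((insNonroot b (c :: F)).map
          fun X => ((linkNonroot X []).map f).sum) = (insNonroot b (c :: F)).map fun _ => 0 := by
        apply List.map_congr_left
        intro X hX
        simp [linkNonroot, this X hX]
      rw [h2]
      simp [linkNonroot]
  | t :: G => fun F f => by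
    have h1 := sum_linkBranch_cons b t
    have h2 := sum_linkNonroot_cons b G
    simp only [linkNonroot, sum_flatMap', sum_map_map', sum_splits_cons, sum_splits_insNonroot,
      insNonroot, List.map_append, List.sum_append, List.sum_map_add, h2]
    have e : ∀ p : Tree S × Tree S,
        ((linkBranch p.1 t).map fun s => ((linkNonroot p.2 G).map fun X =>
          ((insBranch b s).map fun s' => f (s' :: X)).sum).sum).sum =
        ((linkBranch (b :: p.1) t).map fun s =>
          ((linkNonroot p.2 G).map fun X => f (s :: X)).sum).sum +
        ((insNonroot b p.1).map fun Y => ((linkBranch Y t).map fun s =>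
          ((linkNonroot p.2 G).map fun X => f (s :: X)).sum).sum).sum := by
      intro p
      rw [← h1]
      simp only [sum_comm' (linkNonroot p.2 G)]
    have e' : ∀ p : Tree S × Tree S,
        ((linkBranch p.1 t).map fun s => ((insNonroot b p.2).map fun Y =>
          ((linkNonroot Y G).map fun X => f (s :: X)).sum).sum).sum =
        ((insNonroot b p.2).map fun Y => ((linkBranch p.1 t).map fun s =>
          ((linkNonroot Y G).map fun X => f (s :: X)).sum).sum).sum :=
      fun p => sum_comm' _ _ _
    simp only [e, e', List.sum_map_add]
    abel
end

theorem sum_linkings_cons (b : Branch S) (F T : Tree S) (f : Tree S → M) :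
    ((linkings F T).map fun X => f (b :: X) + ((insNonroot b X).map f).sum).sum =
      ((linkings (b :: F) T).map f).sum +
        ((insNonroot b F).map fun X => ((linkings X T).map f).sum).sum :=
  sum_linkings_cons_of b F T (sum_linkNonroot_cons b T) f

end Combinatorics

theorem splits_fst_snd_length {α : Type u} (l : List α) :
    ∀ p ∈ splits l, p.1.length + p.2.length = l.length := by
  induction l with
  | nil => simp [splits]
  | cons a l ih =>
    intro p hp
    simp only [splits, List.mem_flatMap, List.mem_cons, List.not_mem_nil, or_false] at hp
    obtain ⟨q, hq, rfl | rfl⟩ := hp <;> have := ih q hq <;> simp <;> omega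

theorem length_insNonroot {S : Type u} (b : Branch S) (T : Tree S) :
    ∀ X ∈ insNonroot b T, X.length = T.length := by
  induction T with
  | nil => simp [insNonroot]
  | cons t T ih =>
    intro X hX
    simp only [insNonroot, List.mem_append, List.mem_map] at hX
    obtain ⟨Y, _, rfl⟩ | ⟨Y, hY, rfl⟩ := hX
    · simp
    · simp [ih Y hY]

theorem linkNonroot_nil {S : Type u} (T : Tree S) : linkNonroot [] T = [T] := by
  have key : ∀ t : Branch S, linkBranch [] t = [t] := by
    intro t
    induction t using Branch.rec (motive_2 := fun T => linkNonroot [] T = [T]) with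
    | node a L ih => simp [linkBranch, splits, ih]
    | nil => simp [linkNonroot]
    | cons t T ih ih' => simp [linkNonroot, splits, ih, ih']
  induction T with
  | nil => simp [linkNonroot]
  | cons t T ih => simp [linkNonroot, splits, key, ih]

theorem linkings_nil_left {S : Type u} (T : Tree S) : linkings [] T = [T] := by
  simp [linkings, splits, linkNonroot_nil]

theorem linkings_nil_right {S : Type u} (F : Tree S) : linkings F [] = [F] := by
  have key : ∀ (F : Tree S) (g : Tree S → Tree S),
      ((splits F).flatMap fun p => (linkNonroot p.2 []).map fun X => g (p.1 ++ X)) = [g F] := by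
    intro F
    induction F with
    | nil => intro g; simp [splits, linkNonroot]
    | cons b F ih =>
      intro g
      have := ih (fun X => g (b :: X))
      simp only [splits, List.flatMap_assoc, List.flatMap_cons, List.flatMap_nil,
        List.append_nil, List.cons_append]
      simpa [linkNonroot] using this
  exact key F id

noncomputable section

/-- The vector space with basis the ordered trees whose non-root nodes are labeled by elements
of `S`. -/
def KLT (k : Type v) (S : Type u) [Field k] : Type (max u v) := Tree S →₀ k

namespace KLT

variable {k : Type v} {S : Type u} [Field k]

instance : AddCommGroup (KLT k S) := inferInstanceAs (AddCommGroup (Tree S →₀ k))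
instance : Module k (KLT k S) := inferInstanceAs (Module k (Tree S →₀ k))

variable (k) in
/-- A tree, as a basis vector. -/
def of (T : Tree S) : KLT k S := Finsupp.single T 1

variable (k) in
/-- The linear map with prescribed values on trees. -/
def lift {M : Type w} [AddCommMonoid M] [Module k M] (f : Tree S → M) : KLT k S →ₗ[k] M :=
  Finsupp.linearCombination k f

@[simp] theorem lift_of {M : Type w} [AddCommMonoid M] [Module k M] (f : Tree S → M) (T : Tree S) :
    lift k f (of k T) = f T :=
  (Finsupp.linearCombination_single k 1 T).trans (one_smul k _)

theorem hom_ext {M : Type w} [AddCommMonoid M] [Module k M] {f g : KLT k S →ₗ[k] M}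
    (h : ∀ T, f (of k T) = g (of k T)) : f = g :=
  Finsupp.lhom_ext' fun T => LinearMap.ext_ring (h T)

theorem induction_on {P : KLT k S → Prop} (x : KLT k S) (zero : P 0)
    (add : ∀ x y, P x → P y → P (x + y)) (smul : ∀ (c : k) T, P (c • of k T)) : P x := by
  refine Finsupp.induction_linear (motive := P) x zero add fun T c => ?_
  have : (Finsupp.single T c : Tree S →₀ k) = c • Finsupp.single T 1 := by simp
  have h := smul c T
  rw [of] at h
  exact this ▸ h

/-- The product `T₁ · T₂ = ∑_d T_d`, as a bilinear map. -/
def mulMap : KLT k S →ₗ[k] KLT k S →ₗ[k] KLT k S :=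
  lift k fun F => lift k fun T => ((linkings F T).map (of k)).sum

instance : Mul (KLT k S) := ⟨fun x y => mulMap x y⟩

/-- The unit is the tree with one node. -/
instance : One (KLT k S) := ⟨of k []⟩

theorem mul_def (x y : KLT k S) : x * y = mulMap x y := rfl

theorem one_def : (1 : KLT k S) = of k [] := rfl

theorem of_mul_of (F T : Tree S) :
    of k F * of k T = ((linkings F T).map (of k)).sum := by
  simp [mul_def, mulMap]

theorem one_mul' (x : KLT k S) : 1 * x = x := by
  suffices mulMap (1 : KLT k S) = LinearMap.id from LinearMap.congr_fun this x
  refine hom_ext fun T => ?_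
  rw [← mul_def, one_def, of_mul_of, linkings_nil_left]; simp

theorem mul_one' (x : KLT k S) : x * 1 = x := by
  suffices mulMap.flip (1 : KLT k S) = LinearMap.id from LinearMap.congr_fun this x
  refine hom_ext fun T => ?_
  rw [LinearMap.flip_apply, ← mul_def, one_def, of_mul_of, linkings_nil_right]; simp

/-- Linking a branch to the non-root nodes of a tree, in all ways. -/
def insMap (b : Branch S) : KLT k S →ₗ[k] KLT k S :=
  lift k fun T => ((insNonroot b T).map (of k)).sum

/-- Adding a branch at the root. -/
def consMap (b : Branch S) : KLT k S →ₗ[k] KLT k S := lift k fun T => of k (b :: T)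

theorem mulMap_singleton (b : Branch S) :
    mulMap (of k [b]) = consMap b + insMap b := by
  refine hom_ext fun T => ?_
  have := sum_linkings_cons b [] T (of k)
  simp only [linkings_nil_left, insNonroot] at this
  simp only [List.map_cons, List.map_nil, List.sum_cons, List.sum_nil, add_zero] at this
  simp [mulMap, consMap, insMap, this]

theorem singleton_mul_of (b : Branch S) (T : Tree S) :
    of k [b] * of k T = of k (b :: T) + ((insNonroot b T).map (of k)).sum := by
  rw [mul_def, mulMap_singleton]; simp [consMap, insMap]

theorem map_list_sum' {M : Type w} {N : Type*} [AddCommMonoid M] [AddCommMonoid N] [Module k M]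
    [Module k N] {α : Type*} (g : M →ₗ[k] N) (L : List α) (f : α → M) :
    g ((L.map f).sum) = (L.map fun x => g (f x)).sum := by
  rw [map_list_sum, List.map_map]; rfl

theorem list_sum_mul {α : Type*} (L : List α) (f : α → KLT k S) (y : KLT k S) :
    (L.map f).sum * y = (L.map fun x => f x * y).sum :=
  map_list_sum' (mulMap.flip y) L f

theorem mul_list_sum {α : Type*} (L : List α) (f : α → KLT k S) (y : KLT k S) :
    y * (L.map f).sum = (L.map fun x => y * f x).sum :=
  map_list_sum' (mulMap y) L f

theorem add_mul' (x y z : KLT k S) : (x + y) * z = x * z + y * z := by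
  simp [mul_def]

theorem mul_add' (x y z : KLT k S) : x * (y + z) = x * y + x * z := by
  simp [mul_def]

theorem zero_mul' (x : KLT k S) : 0 * x = 0 := by
  simp [mul_def]

theorem mul_zero' (x : KLT k S) : x * 0 = 0 := by
  simp [mul_def]

theorem smul_mul' (c : k) (x y : KLT k S) : (c • x) * y = c • (x * y) := by
  simp [mul_def]

theorem mul_smul' (c : k) (x y : KLT k S) : x * (c • y) = c • (x * y) := by
  simp [mul_def]

theorem sub_mul' (x y z : KLT k S) : (x - y) * z = x * z - y * z := by
  simp [mul_def]

theorem of_cons (b : Branch S) (F : Tree S) :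
    of k (b :: F) = of k [b] * of k F - ((insNonroot b F).map (of k)).sum := by
  rw [singleton_mul_of]; simp

theorem singleton_mul_assoc (b : Branch S) (x y : KLT k S) :
    (of k [b] * x) * y = of k [b] * (x * y) := by
  suffices mulMap ∘ₗ mulMap (of k [b]) =
      (LinearMap.llcomp k _ _ _ (mulMap (of k [b]))) ∘ₗ mulMap from
    LinearMap.congr_fun (LinearMap.congr_fun this x) y
  refine hom_ext fun F => hom_ext fun T => ?_
  change (of k [b] * of k F) * of k T = of k [b] * (of k F * of k T)
  have := sum_linkings_cons b F T (of k)
  rw [singleton_mul_of, add_mul', of_mul_of, list_sum_mul, of_mul_of, mul_list_sum]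
  simp only [singleton_mul_of]
  simp only [of_mul_of]
  exact this.symm

/-- Induction on trees along the product with branches. -/
theorem tree_induction {P : KLT k S → Prop} (one : P 1)
    (sub : ∀ x y, P x → P y → P (x - y)) (zero : P 0) (add : ∀ x y, P x → P y → P (x + y))
    (mul : ∀ b T, P (of k T) → P (of k [b] * of k T)) (T : Tree S) : P (of k T) := by
  have hs : ∀ L : List (Tree S), (∀ X ∈ L, P (of k X)) → P ((L.map (of k)).sum) := by
    intro L
    induction L with
    | nil => intro _; simpa using zero
    | cons X L ih =>
      intro h
      simp only [List.map_cons, List.sum_cons]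
      exact add _ _ (h X (by simp)) (ih fun Y hY => h Y (by simp [hY]))
  generalize hn : T.length = n
  induction n generalizing T with
  | zero =>
    rw [List.length_eq_zero_iff] at hn; subst hn; exact one
  | succ n ih =>
    cases T with
    | nil => simp at hn
    | cons b F =>
      have hF : F.length = n := by simpa using hn
      rw [of_cons]
      refine sub _ _ (mul _ _ (ih F hF)) (hs _ fun X hX => ih X ?_)
      rw [length_insNonroot b F X hX, hF]

theorem mul_assoc' (x y z : KLT k S) : (x * y) * z = x * (y * z) := by
  have key : ∀ F : Tree S, (of k F * y) * z = of k F * (y * z) := by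
    intro F
    refine tree_induction (P := fun x => (x * y) * z = x * (y * z)) ?_ ?_ ?_ ?_ ?_ F
    · simp only [one_mul']
    · intro a b ha hb; simp only [sub_mul', ha, hb]
    · simp [mul_def]
    · intro a b ha hb; simp only [add_mul', ha, hb]
    · intro b T hT; simp only [singleton_mul_assoc, hT]
  refine induction_on (P := fun x => (x * y) * z = x * (y * z)) x (by simp only [zero_mul'])
    (fun a b ha hb => by simp only [add_mul', ha, hb]) ?_
  intro c T
  have := key T
  rw [smul_mul', smul_mul', smul_mul', this]

instance : Ring (KLT k S) where
  __ := (inferInstance : AddCommGroup (KLT k S))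
  left_distrib := mul_add'
  right_distrib := add_mul'
  zero_mul := zero_mul'
  mul_zero := mul_zero'
  mul_assoc := mul_assoc'
  one_mul := one_mul'
  mul_one := mul_one'

instance : Algebra k (KLT k S) :=
  Algebra.ofModule smul_mul' mul_smul'

open scoped TensorProduct

/-- The coproduct `Δ(T) = ∑_X T_X ⊗ T_{F \ X}`, over all sub-multisets `X` of the branches `F` at the
root of `T`. -/
def comulMap : KLT k S →ₗ[k] KLT k S ⊗[k] KLT k S :=
  lift k fun T => ((splits T).map fun p => of k p.1 ⊗ₜ[k] of k p.2).sum

/-- The counit: `1` on the tree with one node, `0` on every other tree. -/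
def counitMap : KLT k S →ₗ[k] k := lift k fun T => if T.isEmpty then 1 else 0

theorem comulMap_of (T : Tree S) :
    comulMap (of k T) = ((splits T).map fun p => of k p.1 ⊗ₜ[k] of k p.2).sum := by
  simp [comulMap]

theorem tmul_list_sum {α : Type*} (L : List α) (f : α → KLT k S) (y : KLT k S) :
    y ⊗ₜ[k] (L.map f).sum = (L.map fun x => y ⊗ₜ[k] f x).sum :=
  map_list_sum' (TensorProduct.mk k _ _ y) L f

theorem list_sum_tmul {α : Type*} (L : List α) (f : α → KLT k S) (y : KLT k S) :
    (L.map f).sum ⊗ₜ[k] y = (L.map fun x => f x ⊗ₜ[k] y).sum :=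
  map_list_sum' ((TensorProduct.mk k _ _).flip y) L f

theorem comulMap_singleton_mul_of (b : Branch S) (T : Tree S) :
    comulMap (of k [b] * of k T) =
      ((of k [b]) ⊗ₜ[k] 1 + 1 ⊗ₜ[k] of k [b]) * comulMap (of k T) := by
  have h := sum_splits_insNonroot b T (fun p => of k p.1 ⊗ₜ[k] of k p.2)
  rw [singleton_mul_of, map_add, comulMap_of, map_list_sum']
  simp only [comulMap_of]
  rw [h, sum_splits_cons, ← List.sum_map_mul_left, ← List.sum_map_add]
  congr 1
  refine List.map_congr_left fun p _ => ?_
  simp only [add_mul, Algebra.TensorProduct.tmul_mul_tmul, one_mul, singleton_mul_of,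
    TensorProduct.add_tmul, TensorProduct.tmul_add, tmul_list_sum, list_sum_tmul]
  abel

theorem comulMap_one : comulMap (1 : KLT k S) = 1 := by
  rw [one_def, comulMap_of]
  simp [splits, Algebra.TensorProduct.one_def, one_def]

theorem comulMap_singleton_mul (b : Branch S) (x : KLT k S) :
    comulMap (of k [b] * x) = ((of k [b]) ⊗ₜ[k] 1 + 1 ⊗ₜ[k] of k [b]) * comulMap x := by
  suffices comulMap ∘ₗ LinearMap.mulLeft k (of k [b]) =
      LinearMap.mulLeft k ((of k [b]) ⊗ₜ[k] 1 + 1 ⊗ₜ[k] of k [b]) ∘ₗ comulMap from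
    LinearMap.congr_fun this x
  exact hom_ext fun T => comulMap_singleton_mul_of b T

theorem comulMap_mul (x y : KLT k S) : comulMap (x * y) = comulMap x * comulMap y := by
  suffices (LinearMap.mul k (KLT k S)).compr₂ comulMap =
      (LinearMap.mul k _).compl₁₂ comulMap comulMap from
    LinearMap.congr_fun (LinearMap.congr_fun this x) y
  refine hom_ext fun F => LinearMap.ext fun y => ?_
  change comulMap (of k F * y) = comulMap (of k F) * comulMap y
  refine tree_induction (P := fun x => comulMap (x * y) = comulMap x * comulMap y)
    ?_ ?_ ?_ ?_ ?_ F
  · rw [one_mul, comulMap_one, one_mul]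
  · intro a b ha hb; simp only [sub_mul, map_sub, ha, hb]
  · simp
  · intro a b ha hb; simp only [add_mul, map_add, ha, hb]
  · intro b T hT
    rw [mul_assoc, comulMap_singleton_mul, comulMap_singleton_mul, hT, mul_assoc]

theorem counitMap_of_nil : counitMap (of k ([] : Tree S)) = 1 := by simp [counitMap]

theorem counitMap_of_cons (b : Branch S) (T : Tree S) : counitMap (of k (b :: T)) = 0 := by
  simp [counitMap]

theorem counitMap_insNonroot (b : Branch S) (T : Tree S) :
    counitMap ((insNonroot b T).map (of k)).sum = 0 := by
  rw [map_list_sum']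
  refine List.sum_eq_zero fun c hc => ?_
  obtain ⟨X, hX, rfl⟩ := List.mem_map.1 hc
  cases T with
  | nil => simp [insNonroot] at hX
  | cons t T =>
    have := length_insNonroot b _ X hX
    cases X with
    | nil => simp at this
    | cons => exact counitMap_of_cons _ _

theorem counitMap_singleton_mul (b : Branch S) (x : KLT k S) :
    counitMap (of k [b] * x) = 0 := by
  suffices counitMap ∘ₗ LinearMap.mulLeft k (of k [b]) = 0 from LinearMap.congr_fun this x
  refine hom_ext fun T => ?_
  simp [singleton_mul_of, counitMap_of_cons, counitMap_insNonroot]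

theorem counitMap_mul (x y : KLT k S) : counitMap (x * y) = counitMap x * counitMap y := by
  suffices (LinearMap.mul k (KLT k S)).compr₂ counitMap =
      (LinearMap.mul k _).compl₁₂ counitMap counitMap from
    LinearMap.congr_fun (LinearMap.congr_fun this x) y
  refine hom_ext fun F => LinearMap.ext fun y => ?_
  change counitMap (of k F * y) = counitMap (of k F) * counitMap y
  refine tree_induction (P := fun x => counitMap (x * y) = counitMap x * counitMap y)
    ?_ ?_ ?_ ?_ ?_ F
  · rw [one_mul, one_def, counitMap_of_nil, one_mul]
  · intro a b ha hb; simp only [sub_mul, map_sub, ha, hb]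
  · simp
  · intro a b ha hb; simp only [add_mul, map_add, ha, hb]
  · intro b T hT
    rw [mul_assoc, counitMap_singleton_mul, counitMap_singleton_mul, zero_mul]

variable (k S) in
/-- The coproduct as an algebra map. -/
def comulHom : KLT k S →ₐ[k] KLT k S ⊗[k] KLT k S :=
  AlgHom.ofLinearMap comulMap comulMap_one comulMap_mul

variable (k S) in
/-- The counit as an algebra map. -/
def counitHom : KLT k S →ₐ[k] k :=
  AlgHom.ofLinearMap counitMap (by rw [one_def, counitMap_of_nil]) counitMap_mul

/-- The algebra is generated by the trees whose root has one child. -/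
theorem algHom_ext {A : Type w} [Ring A] [Algebra k A] {f g : KLT k S →ₐ[k] A}
    (h : ∀ b, f (of k [b]) = g (of k [b])) : f = g := by
  suffices f.toLinearMap = g.toLinearMap from AlgHom.ext fun x => LinearMap.congr_fun this x
  refine hom_ext fun T => ?_
  change f (of k T) = g (of k T)
  refine tree_induction (P := fun x => f x = g x) ?_ ?_ ?_ ?_ ?_ T
  · simp
  · intro a b ha hb; simp only [map_sub, ha, hb]
  · simp
  · intro a b ha hb; simp only [map_add, ha, hb]
  · intro b T hT; rw [map_mul, map_mul, h, hT]

theorem comulHom_singleton (b : Branch S) :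
    comulHom k S (of k [b]) = (of k [b]) ⊗ₜ[k] 1 + 1 ⊗ₜ[k] of k [b] := by
  change comulMap _ = _
  simp [comulMap_of, splits, one_def]

theorem counitHom_singleton (b : Branch S) : counitHom k S (of k [b]) = 0 :=
  counitMap_of_cons b []

instance : Bialgebra k (KLT k S) :=
  Bialgebra.ofAlgHom (comulHom k S) (counitHom k S)
    (algHom_ext fun b => by
      simp [comulHom_singleton, TensorProduct.add_tmul, TensorProduct.tmul_add,
        Algebra.TensorProduct.one_def, add_assoc])
    (algHom_ext fun b => by simp [comulHom_singleton, counitHom_singleton])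
    (algHom_ext fun b => by simp [comulHom_singleton, counitHom_singleton])

/-- The antipode on trees whose root has `n` children: it is determined by
`S(1) = 1` and `S(b · F) = - S(F) · b`. -/
def antipodeAux : ℕ → Tree S → KLT k S
  | _, [] => 1
  | 0, _ :: _ => 0
  | n + 1, b :: F => - (antipodeAux n F * of k [b]) -
      ((insNonroot b F).map (antipodeAux n)).sum

/-- The antipode. -/
def antipodeMap : KLT k S →ₗ[k] KLT k S := lift k fun T => antipodeAux T.length T

theorem antipodeMap_one : antipodeMap (1 : KLT k S) = 1 := by
  simp [antipodeMap, one_def, antipodeAux]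

theorem antipodeMap_singleton_mul (b : Branch S) (x : KLT k S) :
    antipodeMap (of k [b] * x) = - (antipodeMap x * of k [b]) := by
  suffices antipodeMap ∘ₗ LinearMap.mulLeft k (of k [b]) =
      - (LinearMap.mulRight k (of k [b]) ∘ₗ antipodeMap) from LinearMap.congr_fun this x
  refine hom_ext fun T => ?_
  have h : ((insNonroot b T).map fun X => antipodeAux (k := k) X.length X) =
      (insNonroot b T).map (antipodeAux T.length) :=
    List.map_congr_left fun X hX => by rw [length_insNonroot b T X hX]
  simp only [LinearMap.comp_apply, LinearMap.mulLeft_apply, LinearMap.neg_apply,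
    LinearMap.mulRight_apply, singleton_mul_of, map_add, map_list_sum']
  simp [antipodeMap, antipodeAux, h]

theorem antipode_left (b : Branch S) (z : KLT k S ⊗[k] KLT k S) :
    LinearMap.mul' k _ (antipodeMap.rTensor _
      (((of k [b]) ⊗ₜ[k] 1 + 1 ⊗ₜ[k] of k [b]) * z)) = 0 := by
  induction z with
  | zero => simp
  | add x y hx hy => rw [mul_add, map_add, map_add, hx, hy, add_zero]
  | tmul x y =>
    simp [add_mul, antipodeMap_singleton_mul, mul_assoc]

theorem antipode_right (b : Branch S) (z : KLT k S ⊗[k] KLT k S) :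
    LinearMap.mul' k _ (antipodeMap.lTensor _
      (((of k [b]) ⊗ₜ[k] 1 + 1 ⊗ₜ[k] of k [b]) * z)) =
      of k [b] * LinearMap.mul' k _ (antipodeMap.lTensor _ z) -
        LinearMap.mul' k _ (antipodeMap.lTensor _ z) * of k [b] := by
  induction z with
  | zero => simp
  | add x y hx hy =>
    rw [mul_add, map_add, map_add, hx, hy, map_add, map_add, mul_add, add_mul]; abel
  | tmul x y =>
    simp [add_mul, antipodeMap_singleton_mul, mul_assoc, sub_eq_add_neg]

instance : HopfAlgebra k (KLT k S) where
  antipode := antipodeMap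
  mul_antipode_rTensor_comul := by
    refine hom_ext fun T => ?_
    change LinearMap.mul' k _ (antipodeMap.rTensor _ (comulMap (of k T))) =
      algebraMap k _ (counitMap (of k T))
    refine tree_induction (P := fun x => LinearMap.mul' k _ (antipodeMap.rTensor _ (comulMap x)) =
      algebraMap k _ (counitMap x)) ?_ ?_ ?_ ?_ ?_ T
    · rw [comulMap_one, Algebra.TensorProduct.one_def, one_def, counitMap_of_nil, ← one_def]
      simp [antipodeMap_one]
    · intro a b ha hb; simp only [map_sub, ha, hb]
    · simp
    · intro a b ha hb; simp only [map_add, ha, hb]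
    · intro b T _
      rw [comulMap_singleton_mul, antipode_left, counitMap_singleton_mul, map_zero]
  mul_antipode_lTensor_comul := by
    refine hom_ext fun T => ?_
    change LinearMap.mul' k _ (antipodeMap.lTensor _ (comulMap (of k T))) =
      algebraMap k _ (counitMap (of k T))
    refine tree_induction (P := fun x => LinearMap.mul' k _ (antipodeMap.lTensor _ (comulMap x)) =
      algebraMap k _ (counitMap x)) ?_ ?_ ?_ ?_ ?_ T
    · rw [comulMap_one, Algebra.TensorProduct.one_def, one_def, counitMap_of_nil, ← one_def]
      simp [antipodeMap_one]
    · intro a b ha hb; simp only [map_sub, ha, hb]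
    · simp
    · intro a b ha hb; simp only [map_add, ha, hb]
    · intro b T hT
      rw [comulMap_singleton_mul, antipode_right, hT, counitMap_singleton_mul, map_zero,
        Algebra.commutes, sub_self]

end KLT

section Action

/-- A connection on the Lie algebra of derivations of `R`; `nabla E F` is `∇_E F`. -/
structure Connection (k : Type v) (R : Type u) [Field k] [CommRing R] [Algebra k R] where
  /-- The map `(E, F) ↦ ∇_E F`. -/
  nabla : Derivation k R R → Derivation k R R → Derivation k R R
  add_left : ∀ E₁ E₂ F, nabla (E₁ + E₂) F = nabla E₁ F + nabla E₂ F
  add_right : ∀ E F₁ F₂, nabla E (F₁ + F₂) = nabla E F₁ + nabla E F₂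
  smul_left : ∀ (f : R) (E F), nabla (f • E) F = f • nabla E F
  leibniz : ∀ (f : R) (E F), nabla E (f • F) = f • nabla E F + E f • F

/-- `Replaces t t' U U'`: the tree `U'` results from the tree `U` by replacing one occurrence of the
full subtree `t` (a non-root node with all its descendants, at any depth) by `t'`. -/
inductive Replaces {S : Type u} (t t' : Branch S) : Tree S → Tree S → Prop
  | here (A B : Tree S) : Replaces t t' (A ++ t :: B) (A ++ t' :: B)
  | under (A B : Tree S) (a : S) {X Y : Tree S} : Replaces t t' X Y →
      Replaces t t' (A ++ .node a X :: B) (A ++ .node a Y :: B)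

variable {k : Type v} {R : Type u} [Field k] [CommRing R] [Algebra k R]

/-- The rules by which a connection makes every tree labeled by derivations of `R` act on `R`.
* The tree with one node acts as the identity.
* `v(E)` acts as `E`.
* `u(E; v(F))` acts as `∇_F E`.
* If a tree `T` whose root has a single child acts as the derivation `D`, then replacing a subtree
  `T` of a tree `U` by `v(D)` does not change the action of `U`.
* If `T` is a tree whose root has a single child and `U` is any tree, then the sum of trees `T · U`
  acts as `T` after `U`.  As `T · U` is `t(T, U)` plus trees with fewer children at the root, this is
  the recursion for the action of `t(T, U)`; for `U = u(E; T₂, …, Tₙ)` the sum `T · U` consists of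
  `t(T, U)`, of `u(E; T, T₂, …, Tₙ)` and of trees in which `T` is linked to a node of some `Tⱼ`, and
  this is the recursion for the action of `u(E; T, T₂, …, Tₙ)`. -/
structure IsTreeAction (c : Connection k R)
    (φ : KLT k (Derivation k R R) →ₗ[k] Module.End k R) : Prop where
  root : φ (KLT.of k []) = LinearMap.id
  vertex : ∀ E : Derivation k R R, φ (KLT.of k (vTree E)) = E.toLinearMap
  connection : ∀ E F : Derivation k R R,
    φ (KLT.of k (uTree E (vTree F))) = (c.nabla F E).toLinearMap
  coherent : ∀ (t : Branch (Derivation k R R)) (D : Derivation k R R),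
    φ (KLT.of k [t]) = D.toLinearMap →
      ∀ U U', Replaces t (.node D []) U U' → φ (KLT.of k U) = φ (KLT.of k U')
  recursion : ∀ (t : Branch (Derivation k R R)) (U : Tree (Derivation k R R)),
    φ (KLT.of k [t] * KLT.of k U) = φ (KLT.of k [t]) ∘ₗ φ (KLT.of k U)

/-- Left module algebras over a bialgebra `H`: `h · (r s) = ∑ (h₁ · r) (h₂ · s)` and
`h · 1 = ε(h) 1`. -/
structure IsModuleAlgebra (k : Type v) (H : Type w) (R : Type u) [Field k] [Ring H] [Bialgebra k H]
    [CommRing R] [Algebra k R] [Module H R] [IsScalarTower k H R] : Prop where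
  smul_mul : ∀ (h : H) (r s : R), h • (r * s) =
    LinearMap.mul' k R (TensorProduct.map
      ((LinearMap.toSpanSingleton H R r).restrictScalars k)
      ((LinearMap.toSpanSingleton H R s).restrictScalars k) (Coalgebra.comul h))
  smul_one : ∀ h : H, h • (1 : R) = algebraMap k R (Coalgebra.counit h)

variable (k R) in
/-- The algebra of differential operators on `R` generated by the derivations of `R`: the sums of
products of derivations (and scalars).  It lies in every larger algebra of
differential operators, such as the one that contains the multiplications by elements of `R`. -/
def Diff : Subalgebra k (Module.End k R) :=
  Algebra.adjoin k (Set.range fun E : Derivation k R R => E.toLinearMap)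

end Action
end
end OrderedTrees

-- A tree is a recipe for iterated covariant derivatives. For a connection `D` on vectors and an
-- additive action `X` of the vectors on a module, put `∇⁰m = m` and `∇ⁿ⁺¹m(x, L) = X_x(∇ⁿm(L)) - ∑
-- ∇ⁿm(L')`, where `L'` runs over the lists that arise from `L` by applying `D_x` to one entry. A
-- branch with label `a` stands for the derivative of `a` along the values of its children. A whole
-- tree stands for the derivative of the identity of `R` along its branches, where derivations act
-- on endomorphisms by composition.
--
-- Existence rests on `sum_insBranch_evalBranch`: linking `b` to all nodes of a branch amounts to
-- applying `D_b` to its value. Linking at the top node gives the next iterated derivative, linking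
-- further down gives the sum subtracted in the recursion, and the two add up to `D_b`. The same
-- cancellation at the root is the product rule, since `b · U` is `b :: U` plus all ways to link `b`
-- below the root.
--
-- For uniqueness, the product rule makes any solution an algebra map, and trees with one branch
-- generate the algebra; so only their values matter. For a branch with first child `b`, expand `b ·
-- [node a L]`. Coherence reduces the two-branch tree to `D ∘ D' - ∇_D D'`, and the other terms have
-- fewer children at the labeled node, so an induction determines the value.
--
-- Hence one-branch trees act by derivations. They are primitive for the coproduct, so the Leibniz
-- rule gives the module algebra identities on generators, and products carry these identities and
-- the membership in `Diff` to all trees.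

namespace OrderedTrees

noncomputable section

-- Iterated covariant derivatives along lists of vectors

section CovariantDerivatives

variable {V M : Type*} [AddCommGroup V] [AddCommGroup M]

/-- A function on lists that is additive in every entry. -/
def IsMultiAdditive (f : List V → M) : Prop :=
  ∀ A x y B, f (A ++ (x + y) :: B) = f (A ++ x :: B) + f (A ++ y :: B)

theorem IsMultiAdditive.cons {f : List V → M} (hf : IsMultiAdditive f) (x : V) :
    IsMultiAdditive fun L => f (x :: L) :=
  fun A y z B => hf (x :: A) y z B

theorem IsMultiAdditive.head_add {f : List V → M} (hf : IsMultiAdditive f) (x y : V)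
    (L : List V) : f ((x + y) :: L) = f (x :: L) + f (y :: L) :=
  hf [] x y L

theorem IsMultiAdditive.head_sum {f : List V → M} (hf : IsMultiAdditive f) (l L : List V) :
    f (l.sum :: L) = (l.map fun x => f (x :: L)).sum := by
  induction l with
  | nil =>
    -- Additivity at `0 + 0` forces the value at a zero entry to vanish.
    have := hf.head_add 0 0 L
    simpa using this
  | cons x l ih => simp [hf.head_add, ih]

/-- The lists that result from applying an additive map to one entry of a list. -/
def applyAtEntries (g : V →+ V) : List V → List (List V)
  | [] => []
  | x :: L => (g x :: L) :: (applyAtEntries g L).map (x :: ·)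

theorem length_applyAtEntries (g : V →+ V) (L : List V) :
    ∀ X ∈ applyAtEntries g L, X.length = L.length := by
  induction L with
  | nil => simp [applyAtEntries]
  | cons x L ih =>
    intro X hX
    simp only [applyAtEntries, List.mem_cons, List.mem_map] at hX
    obtain rfl | ⟨Y, hY, rfl⟩ := hX
    · simp
    · simp [ih Y hY]

theorem sum_applyAtEntries_append (g : V →+ V) (A B : List V) (f : List V → M) :
    ((applyAtEntries g (A ++ B)).map f).sum =
      ((applyAtEntries g A).map fun X => f (X ++ B)).sum +
        ((applyAtEntries g B).map fun Y => f (A ++ Y)).sum := by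
  induction A generalizing f with
  | nil => simp [applyAtEntries]
  | cons t A ih =>
    simp only [List.cons_append, applyAtEntries, List.map_cons, List.sum_cons, sum_map_map', ih,
      add_assoc]

/-- Each summand contains the map in exactly one entry, where `f` is additive. -/
theorem IsMultiAdditive.sum_applyAtEntries_add {f : List V → M} (hf : IsMultiAdditive f)
    (g h : V →+ V) (L : List V) :
    ((applyAtEntries (g + h) L).map f).sum =
      ((applyAtEntries g L).map f).sum + ((applyAtEntries h L).map f).sum := by
  induction L generalizing f with
  | nil => simp [applyAtEntries]
  | cons x L ih =>
    simp only [applyAtEntries, List.map_cons, List.sum_cons, sum_map_map', ih (hf.cons x),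
      AddMonoidHom.add_apply, hf.head_add]
    abel

/-- The map hits either the split entry, where its own additivity is used, or another entry, where
the split entry is left for `f`. -/
theorem IsMultiAdditive.sum_applyAtEntries {f : List V → M} (hf : IsMultiAdditive f)
    (g : V →+ V) : IsMultiAdditive fun L => ((applyAtEntries g L).map f).sum := by
  intro A x y B
  have h : ∀ X, f (X ++ (x + y) :: B) = f (X ++ x :: B) + f (X ++ y :: B) := fun X => hf X x y B
  have h' : ∀ Y, f (A ++ (x + y) :: Y) = f (A ++ x :: Y) + f (A ++ y :: Y) := fun Y => hf A x y Y
  simp only [sum_applyAtEntries_append, applyAtEntries, List.map_cons, List.sum_cons, sum_map_map',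
    h, h', List.sum_map_add, map_add, hf A (g x) (g y) B]
  abel

variable (D : V →+ V →+ V) (X : V →+ M →+ M) (m : M)

/-- The iterated covariant derivative of `m` along the vectors in a list of length at most the
first argument; longer lists are sent to `0`. -/
def iteratedCovariantAux : ℕ → List V → M
  | _, [] => m
  | 0, _ :: _ => 0
  | n + 1, x :: L => X x (iteratedCovariantAux n L) -
      ((applyAtEntries (D x) L).map (iteratedCovariantAux n)).sum

/-- The iterated covariant derivative of `m` along the vectors in a list, for the connections `D` on
vectors and `X` on the module of `m`. -/
def iteratedCovariant (L : List V) : M := iteratedCovariantAux D X m L.length L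

theorem iteratedCovariant_nil : iteratedCovariant D X m [] = m := rfl

/-- The bound on the length disappears from the recursion because applying `D x` to an entry
preserves the length. -/
theorem iteratedCovariant_cons (x : V) (L : List V) :
    iteratedCovariant D X m (x :: L) = X x (iteratedCovariant D X m L) -
      ((applyAtEntries (D x) L).map (iteratedCovariant D X m)).sum := by
  have : (applyAtEntries (D x) L).map (iteratedCovariant D X m) =
      (applyAtEntries (D x) L).map (iteratedCovariantAux D X m L.length) :=
    List.map_congr_left fun Y hY => by
      rw [iteratedCovariant, length_applyAtEntries _ _ Y hY]
  rw [this]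
  rfl

/-- The bound `n` is kept fixed so that the induction can run over it. The first entry enters
through `X` and `D`, both additive; later entries are handled by
`IsMultiAdditive.sum_applyAtEntries`. -/
theorem isMultiAdditive_iteratedCovariantAux (n : ℕ) :
    IsMultiAdditive (iteratedCovariantAux D X m n) := by
  induction n with
  -- All three lists are nonempty, so each value is the default `0`.
  | zero => intro A x y B; cases A <;> simp [iteratedCovariantAux]
  | succ n ih =>
    intro A x y B
    cases A with
    | nil =>
      simp only [List.nil_append, iteratedCovariantAux, map_add, AddMonoidHom.add_apply,
        ih.sum_applyAtEntries_add]
      abel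
    | cons z A =>
      have := ih.sum_applyAtEntries (D z) A x y B
      simp only [List.cons_append, iteratedCovariantAux, ih A x y B, map_add, this]
      abel

theorem isMultiAdditive_iteratedCovariant : IsMultiAdditive (iteratedCovariant D X m) := by
  intro A x y B
  simpa [iteratedCovariant] using isMultiAdditive_iteratedCovariantAux D X m _ A x y B

end CovariantDerivatives

-- Values of branches, and linking as covariant differentiation

section Evaluation

variable {V M : Type*} [AddCommGroup V] [AddCommGroup M] (D : V →+ V →+ V)

/-- The vector that a branch labeled by vectors stands for: the iterated covariant derivative of
its label along the vectors of its children. -/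
def evalBranch : Branch V → V
  | .node a L => iteratedCovariant D D a (L.map evalBranch)

theorem evalBranch_node (a : V) (L : Tree V) :
    evalBranch D (.node a L) = iteratedCovariant D D a (L.map (evalBranch D)) := by
  rw [evalBranch]

theorem evalBranch_leaf (a : V) : evalBranch D (.node a []) = a := by
  rw [evalBranch_node, List.map_nil, iteratedCovariant_nil]

/-- A non-root node lies in exactly one branch `t` of `L`, and `f` is additive in the entry of `t`.
The identity for single branches is a hypothesis, restricted to members of `L`, so that it can serve
as induction hypothesis in `sum_insBranch_evalBranch`. -/
theorem sum_insNonroot_of_evalBranch (b : Branch V) (L : Tree V)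
    (h : ∀ t ∈ L, ((insBranch b t).map (evalBranch D)).sum = D (evalBranch D b) (evalBranch D t))
    {f : List V → M} (hf : IsMultiAdditive f) :
    ((insNonroot b L).map fun Y => f (Y.map (evalBranch D))).sum =
      ((applyAtEntries (D (evalBranch D b)) (L.map (evalBranch D))).map f).sum := by
  induction L generalizing f with
  | nil => simp [insNonroot, applyAtEntries]
  | cons t L ih =>
    have ih' := ih (fun s hs => h s (List.mem_cons_of_mem _ hs)) (hf.cons (evalBranch D t))
    have ht := hf.head_sum ((insBranch b t).map (evalBranch D)) (L.map (evalBranch D))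
    rw [h t (by simp), sum_map_map'] at ht
    simp only [insNonroot, List.map_append, List.sum_append, sum_map_map', List.map_cons,
      applyAtEntries, List.sum_cons, ih', ht]

/-- Linking at the top node prepends `b` to the children; the recursion for the iterated derivative
then subtracts exactly the sum that linking at the lower nodes contributes. -/
theorem sum_insBranch_evalBranch (b t : Branch V) :
    ((insBranch b t).map (evalBranch D)).sum = D (evalBranch D b) (evalBranch D t) := by
  -- `Branch` is a nested inductive type; the second motive carries the claim for all members of a
  -- list of children.
  refine Branch.rec
    (motive_1 := fun t =>
      ((insBranch b t).map (evalBranch D)).sum = D (evalBranch D b) (evalBranch D t))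
    (motive_2 := fun L => ∀ t ∈ L,
      ((insBranch b t).map (evalBranch D)).sum = D (evalBranch D b) (evalBranch D t))
    (fun a L ih => ?_) (fun _ h => absurd h List.not_mem_nil)
    (fun _ _ ht hL => List.forall_mem_cons.2 ⟨ht, hL⟩) t
  have := sum_insNonroot_of_evalBranch D b L ih (isMultiAdditive_iteratedCovariant D D a)
  simp only [insBranch, List.map_cons, List.sum_cons, sum_map_map', evalBranch_node,
    iteratedCovariant_cons] at this ⊢
  rw [this, sub_add_cancel]

theorem sum_insNonroot_evalBranch (b : Branch V) (L : Tree V) {f : List V → M}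
    (hf : IsMultiAdditive f) :
    ((insNonroot b L).map fun Y => f (Y.map (evalBranch D))).sum =
      ((applyAtEntries (D (evalBranch D b)) (L.map (evalBranch D))).map f).sum :=
  sum_insNonroot_of_evalBranch D b L (fun t _ => sum_insBranch_evalBranch D b t) hf

/-- The value of a branch depends on its children only through their values, so a replacement at any
depth goes unnoticed. -/
theorem map_evalBranch_of_replaces {t t' : Branch V} (h : evalBranch D t = evalBranch D t')
    {U U' : Tree V} (hU : Replaces t t' U U') :
    U.map (evalBranch D) = U'.map (evalBranch D) := by
  induction hU with
  | here A B => simp [h]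
  | under A B a _ ih => simp [evalBranch_node, ih]

end Evaluation

-- Linking preserves size

section Size

mutual
-- Linking moves `b` without creating or losing nodes. In the companion statement for lists the
-- result has the size of `b :: T`, which the uniqueness induction needs.
theorem sizeOf_of_mem_insBranch {S : Type*} [SizeOf S] (b : Branch S) : ∀ (t : Branch S),
    ∀ s ∈ insBranch b t, sizeOf s = sizeOf b + sizeOf t + 1
  | .node a L => fun s hs => by
    simp only [insBranch, List.mem_cons, List.mem_map] at hs
    obtain rfl | ⟨X, hX, rfl⟩ := hs
    · simp; omega
    · have := sizeOf_of_mem_insNonroot b L X hX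
      simp; omega
theorem sizeOf_of_mem_insNonroot {S : Type*} [SizeOf S] (b : Branch S) : ∀ (T : Tree S),
    ∀ X ∈ insNonroot b T, sizeOf X = sizeOf b + sizeOf T + 1
  | [] => by simp [insNonroot]
  | t :: G => fun X hX => by
    simp only [insNonroot, List.mem_append, List.mem_map] at hX
    obtain ⟨s, hs, rfl⟩ | ⟨Y, hY, rfl⟩ := hX
    · have := sizeOf_of_mem_insBranch b t s hs
      simp; omega
    · have := sizeOf_of_mem_insNonroot b G Y hY
      simp; omega
end

end Size

-- Existence of the tree action

section Action

variable {k : Type v} {R : Type u} [Field k] [CommRing R] [Algebra k R]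

/-- A connection as a biadditive map. -/
def Connection.nablaHom (c : Connection k R) :
    Derivation k R R →+ Derivation k R R →+ Derivation k R R :=
  AddMonoidHom.mk' (fun E => AddMonoidHom.mk' (c.nabla E) (c.add_right E))
    fun E₁ E₂ => AddMonoidHom.ext (c.add_left E₁ E₂)

theorem Connection.nablaHom_apply (c : Connection k R) (E F : Derivation k R R) :
    c.nablaHom E F = c.nabla E F := rfl

variable (k R) in
/-- The inclusion of the derivations into the endomorphisms. -/
def toEndHom : Derivation k R R →+ Module.End k R :=
  AddMonoidHom.mk' (fun E => E.toLinearMap) fun _ _ => rfl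

theorem toEndHom_apply (E : Derivation k R R) : toEndHom k R E = E.toLinearMap := rfl

variable (k R) in
/-- Derivations acting on endomorphisms by composition. -/
def compHom : Derivation k R R →+ Module.End k R →+ Module.End k R :=
  AddMonoidHom.mul.comp (toEndHom k R)

theorem compHom_apply (E : Derivation k R R) (f : Module.End k R) :
    compHom k R E f = E.toLinearMap ∘ₗ f := rfl

/-- The action of a tree labeled by derivations. -/
def Connection.evalTree (c : Connection k R) (T : Tree (Derivation k R R)) : Module.End k R :=
  iteratedCovariant c.nablaHom (compHom k R) LinearMap.id (T.map (evalBranch c.nablaHom))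

/-- The action of the linear combinations of trees labeled by derivations. -/
def Connection.treeAction (c : Connection k R) :
    KLT k (Derivation k R R) →ₗ[k] Module.End k R :=
  KLT.lift k c.evalTree

theorem Connection.treeAction_of (c : Connection k R) (T : Tree (Derivation k R R)) :
    c.treeAction (KLT.of k T) = c.evalTree T :=
  KLT.lift_of _ _

/-- With a single branch no other entry is left to correct, and composing with the identity changes
nothing. Hence one-branch trees act by derivations. -/
theorem Connection.treeAction_singleton (c : Connection k R) (t : Branch (Derivation k R R)) :
    c.treeAction (KLT.of k [t]) = (evalBranch c.nablaHom t).toLinearMap := by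
  rw [c.treeAction_of]
  simp [evalTree, iteratedCovariant_cons, iteratedCovariant_nil, applyAtEntries, compHom_apply]

theorem Connection.isTreeAction_treeAction (c : Connection k R) :
    IsTreeAction c c.treeAction where
  root := by
    rw [c.treeAction_of]
    rfl
  vertex E := by rw [vTree, c.treeAction_singleton, evalBranch_leaf]
  connection E F := by
    rw [uTree, c.treeAction_singleton, evalBranch_node, vTree, List.map_singleton, evalBranch_leaf,
      iteratedCovariant_cons, iteratedCovariant_nil]
    simp [applyAtEntries, c.nablaHom_apply]
  coherent t D h U U' hU := by
    rw [c.treeAction_singleton] at h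
    -- A derivation is determined by its linear map, so `D` is the value of `t` itself.
    have h' : evalBranch c.nablaHom t = D := Derivation.ext fun r => LinearMap.congr_fun h r
    rw [c.treeAction_of, c.treeAction_of, evalTree, evalTree,
      map_evalBranch_of_replaces _ (by rw [h', evalBranch_leaf]) hU]
  recursion t U := by
    rw [KLT.singleton_mul_of, map_add, KLT.map_list_sum', c.treeAction_singleton]
    simp only [c.treeAction_of, evalTree, List.map_cons]
    -- The linkings below the root sum to the correction term of the recursion and cancel it.
    rw [sum_insNonroot_evalBranch c.nablaHom t U (isMultiAdditive_iteratedCovariant _ _ _),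
      iteratedCovariant_cons, sub_add_cancel, compHom_apply]

-- Consequences of the rules: multiplicativity and uniqueness

namespace IsTreeAction

variable {c : Connection k R} {φ : KLT k (Derivation k R R) →ₗ[k] Module.End k R}

/-- The recursion rule is multiplicativity for a one-branch left factor; such trees generate the
algebra, and associativity does the rest. -/
theorem map_mul (h : IsTreeAction c φ) (x y : KLT k (Derivation k R R)) :
    φ (x * y) = φ x * φ y := by
  have hs : ∀ b y, φ (KLT.of k [b] * y) = φ (KLT.of k [b]) * φ y := fun b y => by
    suffices φ ∘ₗ LinearMap.mulLeft k (KLT.of k [b]) =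
        LinearMap.mulLeft k (φ (KLT.of k [b])) ∘ₗ φ from LinearMap.congr_fun this y
    exact KLT.hom_ext fun T => h.recursion b T
  suffices (LinearMap.mul k (KLT k (Derivation k R R))).compr₂ φ =
      (LinearMap.mul k _).compl₁₂ φ φ from LinearMap.congr_fun (LinearMap.congr_fun this x) y
  refine KLT.hom_ext fun F => LinearMap.ext fun y => ?_
  change φ (KLT.of k F * y) = φ (KLT.of k F) * φ y
  refine KLT.tree_induction (P := fun x => φ (x * y) = φ x * φ y) ?_ ?_ ?_ ?_ ?_ F
  · rw [one_mul, KLT.one_def, h.root]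
    rfl
  · intro a b ha hb; simp only [sub_mul, map_sub, ha, hb]
  · simp
  · intro a b ha hb; simp only [add_mul, map_add, ha, hb]
  · intro b T hT
    rw [mul_assoc, hs, hT, hs, mul_assoc]

/-- A tree action as an algebra map. -/
def toAlgHom (h : IsTreeAction c φ) : KLT k (Derivation k R R) →ₐ[k] Module.End k R :=
  AlgHom.ofLinearMap φ h.root h.map_mul

/-- Expand `v(E) · v(F)`: besides the pair it contains only `u(F; v(E))`, which acts as `∇_E F`. -/
theorem map_pair (h : IsTreeAction c φ) (E F : Derivation k R R) :
    φ (KLT.of k [.node E [], .node F []]) =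
      E.toLinearMap ∘ₗ F.toLinearMap - (c.nabla E F).toLinearMap := by
  have hr := h.recursion (.node E []) (vTree F)
  have hE : φ (KLT.of k [.node E []]) = E.toLinearMap := h.vertex E
  have hc : φ (KLT.of k [.node F [.node E []]]) = (c.nabla E F).toLinearMap := h.connection F E
  rw [KLT.singleton_mul_of, map_add, h.vertex, hE] at hr
  simp only [vTree, insNonroot, insBranch, List.map_cons, List.map_nil, List.append_nil,
    List.sum_cons, List.sum_nil, add_zero, hc] at hr
  rw [← hr, add_sub_cancel_right]

/-- Strong induction on the size of the list of children, and inside it induction on their number.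
Both `b` and `node a L` have child lists of smaller size; linking `b` into `L` keeps the size of `b
:: L` but leaves one child fewer. -/
theorem map_singleton_of_lt (h : IsTreeAction c φ) (n m : ℕ) : ∀ (a : Derivation k R R)
    (L : Tree (Derivation k R R)), sizeOf L = n → L.length = m →
      φ (KLT.of k [.node a L]) = (evalBranch c.nablaHom (.node a L)).toLinearMap := by
  induction n using Nat.strong_induction_on generalizing m with
  | _ n ihn =>
  induction m with
  | zero =>
    intro a L _ hL
    rw [List.length_eq_zero_iff] at hL
    subst hL
    rw [evalBranch_leaf]
    exact h.vertex a
  | succ m ihm =>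
    rintro a (_ | ⟨b, L⟩) hn hm
    · simp at hm
    have hb : φ (KLT.of k [b]) = (evalBranch c.nablaHom b).toLinearMap := by
      obtain ⟨e, B⟩ := b
      exact ihn (sizeOf B) (by simp at hn; omega) _ e B rfl rfl
    have hL : φ (KLT.of k [.node a L]) = (evalBranch c.nablaHom (.node a L)).toLinearMap :=
      ihn (sizeOf L) (by simp at hn; omega) _ a L rfl rfl
    have hX : ∀ X ∈ insNonroot b L,
        φ (KLT.of k [.node a X]) = (evalBranch c.nablaHom (.node a X)).toLinearMap := by
      intro X hX
      refine ihm a X ?_ ?_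
      · rw [sizeOf_of_mem_insNonroot b L X hX, ← hn]
        simp; omega
      · rw [length_insNonroot b L X hX]
        simpa using hm
    have hpair : φ (KLT.of k [b, .node a L]) =
        (evalBranch c.nablaHom b).toLinearMap ∘ₗ
          (evalBranch c.nablaHom (.node a L)).toLinearMap -
        (c.nabla (evalBranch c.nablaHom b) (evalBranch c.nablaHom (.node a L))).toLinearMap := by
      rw [← h.map_pair]
      -- Coherence replaces one branch at a time by a leaf labeled with its value, which reduces to
      -- `map_pair`.
      exact (h.coherent b _ hb _ _ (Replaces.here [] [.node a L])).trans
        (h.coherent _ _ hL _ _ (Replaces.here [.node (evalBranch c.nablaHom b) []] []))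
    have hsum := congrArg (toEndHom k R) (sum_insBranch_evalBranch c.nablaHom b (.node a L))
    have hr := h.recursion b [.node a L]
    have hX' := congrArg List.sum (List.map_congr_left hX)
    rw [KLT.singleton_mul_of, map_add, KLT.map_list_sum', hpair, hb, hL] at hr
    simp only [insNonroot, insBranch, List.map_nil, List.append_nil, sum_map_map', List.map_cons,
      List.sum_cons, hX'] at hr
    simp only [insBranch, List.map_cons, List.sum_cons, map_add, map_list_sum, List.map_map,
      Function.comp_def, toEndHom_apply, c.nablaHom_apply] at hsum
    rw [← hsum] at hr
    -- In `hr` the composition occurs on both sides, and the terms of `insNonroot b L` cancel; the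
    -- difference of the two sides wanted remains.
    refine sub_eq_zero.1 (Eq.trans ?_ (sub_eq_zero.2 hr))
    abel

theorem map_singleton (h : IsTreeAction c φ) (b : Branch (Derivation k R R)) :
    φ (KLT.of k [b]) = (evalBranch c.nablaHom b).toLinearMap := by
  obtain ⟨a, L⟩ := b
  exact h.map_singleton_of_lt _ _ a L rfl rfl

theorem ext {φ' : KLT k (Derivation k R R) →ₗ[k] Module.End k R} (h : IsTreeAction c φ)
    (h' : IsTreeAction c φ') : φ = φ' := by
  have : h.toAlgHom = h'.toAlgHom :=
    KLT.algHom_ext fun b => (h.map_singleton b).trans (h'.map_singleton b).symm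
  exact congrArg AlgHom.toLinearMap this

theorem mem_diff (h : IsTreeAction c φ) (x : KLT k (Derivation k R R)) : φ x ∈ Diff k R := by
  have key : ∀ T, φ (KLT.of k T) ∈ Diff k R := by
    refine KLT.tree_induction (P := fun x => φ x ∈ Diff k R) ?_ ?_ ?_ ?_ ?_
    · rw [KLT.one_def, h.root]
      exact one_mem _
    · intro a b ha hb
      rw [map_sub]
      exact sub_mem ha hb
    · rw [map_zero]
      exact zero_mem _
    · intro a b ha hb
      rw [map_add]
      exact add_mem ha hb
    · intro b T hT
      rw [h.map_mul, h.map_singleton]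
      exact mul_mem (Algebra.subset_adjoin ⟨_, rfl⟩) hT
  refine KLT.induction_on (P := fun x => φ x ∈ Diff k R) x ?_ ?_ ?_
  · rw [map_zero]
    exact zero_mem _
  · intro a b ha hb
    rw [map_add]
    exact add_mem ha hb
  · intro r T
    rw [map_smul]
    exact Subalgebra.smul_mem _ (key T) r

-- Compatibility with the coproduct and the counit

open scoped TensorProduct in
/-- An element `∑ x ⊗ y` acts on `r`, `s` by `∑ φ(x)(r) φ(y)(s)`. -/
def tensorAction (φ : KLT k (Derivation k R R) →ₗ[k] Module.End k R) (r s : R) :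
    KLT k (Derivation k R R) ⊗[k] KLT k (Derivation k R R) →ₗ[k] R :=
  LinearMap.mul' k R ∘ₗ TensorProduct.map (φ.flip r) (φ.flip s)

open scoped TensorProduct in
-- The left factor is the coproduct of a primitive element, and one-branch trees act by derivations:
-- this is the Leibniz rule on a product of two values.
theorem tensorAction_singleton_mul (h : IsTreeAction c φ) (b : Branch (Derivation k R R)) (r s : R)
    (z) : tensorAction φ r s ((KLT.of k [b] ⊗ₜ[k] 1 + 1 ⊗ₜ[k] KLT.of k [b]) * z) =
      φ (KLT.of k [b]) (tensorAction φ r s z) := by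
  induction z with
  | zero => simp
  | add x y hx hy => simp only [mul_add, map_add] at hx hy ⊢; rw [← hx, ← hy]
  | tmul x y =>
    have : ∀ x, φ (KLT.of k [b] * x) = φ (KLT.of k [b]) * φ x := h.map_mul _
    simp only [add_mul, Algebra.TensorProduct.tmul_mul_tmul, one_mul, map_add, tensorAction,
      LinearMap.comp_apply, TensorProduct.map_tmul, LinearMap.flip_apply, LinearMap.mul'_apply,
      this, h.map_singleton, Module.End.mul_apply, Derivation.coeFn_coe, Derivation.leibniz,
      smul_eq_mul]
    ring

theorem map_apply_mul (h : IsTreeAction c φ) (x : KLT k (Derivation k R R)) (r s : R) :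
    φ x (r * s) = tensorAction φ r s (KLT.comulMap x) := by
  suffices φ.flip (r * s) = tensorAction φ r s ∘ₗ KLT.comulMap from LinearMap.congr_fun this x
  refine KLT.hom_ext fun T => ?_
  refine KLT.tree_induction
    (P := fun x => φ x (r * s) = tensorAction φ r s (KLT.comulMap x)) ?_ ?_ ?_ ?_ ?_ T
  · rw [KLT.comulMap_one, Algebra.TensorProduct.one_def]
    simp [tensorAction, KLT.one_def, h.root]
  · intro a b ha hb; simp only [map_sub, LinearMap.sub_apply, ha, hb]
  · simp
  · intro a b ha hb; simp only [map_add, LinearMap.add_apply, ha, hb]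
  · intro b T hT
    rw [h.map_mul, Module.End.mul_apply, hT, KLT.comulMap_singleton_mul,
      h.tensorAction_singleton_mul]

/-- Derivations kill the image of `k`, while the counit kills every product with a one-branch left
factor. -/
theorem map_apply_one (h : IsTreeAction c φ) (x : KLT k (Derivation k R R)) :
    φ x 1 = algebraMap k R (KLT.counitMap x) := by
  suffices φ.flip 1 = Algebra.linearMap k R ∘ₗ KLT.counitMap from LinearMap.congr_fun this x
  refine KLT.hom_ext fun T => ?_
  refine KLT.tree_induction
    (P := fun x => φ x 1 = algebraMap k R (KLT.counitMap x)) ?_ ?_ ?_ ?_ ?_ T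
  · rw [KLT.one_def, KLT.counitMap_of_nil, h.root]
    simp
  · intro a b ha hb; simp only [map_sub, LinearMap.sub_apply, ha, hb]
  · simp
  · intro a b ha hb; simp only [map_add, LinearMap.add_apply, ha, hb]
  · intro b T hT
    rw [h.map_mul, Module.End.mul_apply, hT, KLT.counitMap_singleton_mul, h.map_singleton]
    simp

end IsTreeAction
end Action
end
end OrderedTrees

theorem theorem3p1 {k : Type v} {R : Type u} [Field k] [CommRing R] [Algebra k R]
    (c : OrderedTrees.Connection k R) :
    (∃! φ : OrderedTrees.KLT k (Derivation k R R) →ₗ[k] Module.End k R,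
      OrderedTrees.IsTreeAction c φ) ∧
    ∃ ψ : OrderedTrees.KLT k (Derivation k R R) →ₐ[k] Module.End k R,
      OrderedTrees.IsTreeAction c ψ.toLinearMap ∧
      (∃ (_ : Module (OrderedTrees.KLT k (Derivation k R R)) R)
        (_ : IsScalarTower k (OrderedTrees.KLT k (Derivation k R R)) R),
        (∀ (h : OrderedTrees.KLT k (Derivation k R R)) (r : R), h • r = ψ h r) ∧
        OrderedTrees.IsModuleAlgebra k (OrderedTrees.KLT k (Derivation k R R)) R) ∧
      ∀ h : OrderedTrees.KLT k (Derivation k R R), ψ h ∈ OrderedTrees.Diff k R := by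
  have h := c.isTreeAction_treeAction
  let _ : Module (OrderedTrees.KLT k (Derivation k R R)) R :=
    Module.compHom R h.toAlgHom.toRingHom
  have : IsScalarTower k (OrderedTrees.KLT k (Derivation k R R)) R :=
    ⟨fun a x r => LinearMap.congr_fun (map_smul c.treeAction a x) r⟩
  exact ⟨⟨c.treeAction, h, fun φ hφ => hφ.ext h⟩, h.toAlgHom, h,
    ⟨inferInstance, inferInstance, fun _ _ => rfl, ⟨h.map_apply_mul, h.map_apply_one⟩⟩,
    h.mem_diff⟩
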